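/- Let $n\ge 1$, let $A\in\mathbb{R}^{n\times n}$ be Hurwitz (all eigenvalues have negative real part), let $B,v\in\mathbb{R}^n$ with $(A,B)$ controllable (i.e. $\operatorname{rank}(B\ \ AB\ \cdots\ A^{n-1}B)=n$), and let $\kappa>0$. Put $$G(\mathrm{j}\omega)=(\mathrm{j}\omega I_n-A)^{-1}B,\qquad f(\omega,\kappa,\vartheta,v)=2\,\mathrm{Re}\{v^\top G(\mathrm{j}\omega)\}+\kappa\,|v^\top G(\mathrm{j}\omega)|^2-\vartheta\,\|G(\mathrm{j}\omega)\|^2,$$ where $\|\cdot\|$ is the Euclidean norm. For $\psi>0$ consider the linear matrix inequality $$A^\top P+PA+(\psi+\kappa\|v\|^2)I_n-\kappa vv^\top\le 0,\qquad PB=v\qquad(\ast)$$ for a real symmetric matrix $P=P^\top\in\mathbb{R}^{n\times n}$, and let $\Psi$ be the set of all $\psi>0$ for which $(\ast)$ is feasible. Then: 1. $\Psi$ is nonempty if and only if $f(\omega,\kappa,\kappa\|v\|^2,v)>0$ for all $\omega\in\mathbb{R}$ and $\lim_{\omega\to\infty}\|G(\mathrm{j}\omega)\|^{-2}f(\omega,\kappa,\kappa\|v\|^2,v)>0$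 (the limit existing in $\mathbb{R}$). 2. For every $\psi\in\Psi$, every symmetric solution $P$ of $(\ast)$ satisfies $P>0$ and $Q:=-(A^\top P+PA)>0$. 3. If moreover, for this $\psi$, there is $\omega\in\mathbb{R}$ with $f(\omega,0,\psi+\kappa\|v\|^2,v)<0$, then $\lambda_{\min}(Q+PBB^\top P)>\lambda_{\min}(Q)$, where $\lambda_{\min}$ denotes the minimal eigenvalue of a real symmetric matrix. -/

import Mathlib

namespace StaticAdaptation

open Matrix

/-- The Euclidean norm of a vector with entries in `ℝ` or `ℂ`. -/
noncomputable def euclNorm {𝕜 : Type*} [RCLike 𝕜] {n : ℕ} (x : Fin n → 𝕜) : ℝ :=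
  ‖(WithLp.toLp 2 x : EuclideanSpace 𝕜 (Fin n))‖

/-- A real square matrix is Hurwitz if all its (complex) eigenvalues have negative real part. -/
def IsHurwitz {n : ℕ} (A : Matrix (Fin n) (Fin n) ℝ) : Prop :=
  ∀ s ∈ spectrum ℂ (A.map Complex.ofReal), s.re < 0

/-- The controllability matrix `(B, A B, …, A ^ (n - 1) B)` of a single-input pair. -/
def controllabilityMatrix {n : ℕ} (A : Matrix (Fin n) (Fin n) ℝ) (B : Fin n → ℝ) :
    Matrix (Fin n) (Fin n) ℝ :=
  Matrix.of fun i k => ((A ^ (k : ℕ)) *ᵥ B) i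

/-- The pair `(A, B)` is controllable: the controllability matrix has full rank. -/
def IsControllable {n : ℕ} (A : Matrix (Fin n) (Fin n) ℝ) (B : Fin n → ℝ) : Prop :=
  (controllabilityMatrix A B).rank = n

/-- The minimal eigenvalue of a real symmetric matrix of positive size. -/
noncomputable def lambdaMin {n : ℕ} (M : Matrix (Fin n) (Fin n) ℝ) : ℝ :=
  sInf (spectrum ℝ M)

/-- For a symmetric matrix of positive size, `lambdaMin` is indeed the least eigenvalue. -/
theorem lambdaMin_isLeast {n : ℕ} (hn : 0 < n) {M : Matrix (Fin n) (Fin n) ℝ} (hM : M.IsSymm) :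
    IsLeast (spectrum ℝ M) (lambdaMin M) := by
  have hH : M.IsHermitian := by
    unfold Matrix.IsHermitian
    rw [Matrix.conjTranspose_eq_transpose_of_trivial]
    exact hM
  have hfin : (spectrum ℝ M).Finite := Matrix.finite_real_spectrum
  have hne : (spectrum ℝ M).Nonempty := ⟨_, hH.eigenvalues_mem_spectrum_real ⟨0, hn⟩⟩
  exact ⟨hne.csInf_mem hfin, fun x hx => csInf_le hfin.bddBelow hx⟩

/-- `g(φ, Q, w) = λ_min(Q + φ w wᵀ)`. -/
noncomputable def g {n : ℕ} (φ : ℝ) (Q : Matrix (Fin n) (Fin n) ℝ) (w : Fin n → ℝ) : ℝ :=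
  lambdaMin (Q + φ • vecMulVec w w)

/-- `G(s) = (s I - A)⁻¹ B`. -/
noncomputable def G {n : ℕ} (A : Matrix (Fin n) (Fin n) ℝ) (B : Fin n → ℝ) (s : ℂ) :
    Fin n → ℂ :=
  (s • (1 : Matrix (Fin n) (Fin n) ℂ) - A.map Complex.ofReal)⁻¹ *ᵥ fun i => (B i : ℂ)

/-- `f(ω, κ, ϑ, v) = 2 Re(vᵀ G(jω)) + κ |vᵀ G(jω)|² - ϑ ‖G(jω)‖²`. -/
noncomputable def f {n : ℕ} (A : Matrix (Fin n) (Fin n) ℝ) (B : Fin n → ℝ)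
    (ω κ ϑ : ℝ) (v : Fin n → ℝ) : ℝ :=
  2 * ((fun i => (v i : ℂ)) ⬝ᵥ G A B (Complex.I * ω)).re
    + κ * ‖(fun i => (v i : ℂ)) ⬝ᵥ G A B (Complex.I * ω)‖ ^ 2
    - ϑ * euclNorm (G A B (Complex.I * ω)) ^ 2

/-- The symmetric matrix `P` solves
`Aᵀ P + P A + (ψ + κ ‖v‖²) I - κ v vᵀ ≤ 0`, `P B = v`. -/
def SolvesLMI {n : ℕ} (A : Matrix (Fin n) (Fin n) ℝ) (B v : Fin n → ℝ) (κ ψ : ℝ)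
    (P : Matrix (Fin n) (Fin n) ℝ) : Prop :=
  P.IsSymm ∧
  (-(Aᵀ * P + P * A + (ψ + κ * euclNorm v ^ 2) • (1 : Matrix (Fin n) (Fin n) ℝ)
      - κ • vecMulVec v v)).PosSemidef ∧
  P *ᵥ B = v

/-- The set of `ψ > 0` for which the linear matrix inequality is feasible. -/
def Psi {n : ℕ} (A : Matrix (Fin n) (Fin n) ℝ) (B v : Fin n → ℝ) (κ : ℝ) : Set ℝ :=
  {ψ | 0 < ψ ∧ ∃ P : Matrix (Fin n) (Fin n) ℝ, SolvesLMI A B v κ ψ P}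

/-- The matrix `Q = -(Aᵀ P + P A)` of the Lyapunov equation. -/
def lyapunovQ {n : ℕ} (A P : Matrix (Fin n) (Fin n) ℝ) : Matrix (Fin n) (Fin n) ℝ :=
  -(Aᵀ * P + P * A)

end StaticAdaptation

/-! Put ϑ = ψ + κ‖v‖². When PB = v, evaluating the quadratic form of the inequality at Re G(jω) and
Im G(jω) and adding cancels the terms containing both ω and P and leaves -f(ω, κ, ϑ, v). Feasibility
therefore forces f(ω, κ, κ‖v‖², v) ≥ ψ‖G(jω)‖², which gives both frequency conditions. Conversely,
f/‖G‖² is continuous and has one common limit at ±∞, so the two conditions bound it below by some ψ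
> 0; then f(ω, κ, ϑ, v) ≥ 0 for all ω, and the Kalman–Yakubovich–Popov lemma
`IsHurwitz.exists_lmi_solution` supplies P.

That lemma is proved by duality. The pairs (N + AᵀP + PA, PB) with N ≥ 0 and P symmetric form a
convex cone, closed because (A, B) is controllable. If the required point lies outside, separation
yields X ≥ 0 and y with AX + XAᵀ + Byᵀ + yBᵀ = 0 and ϑ tr X - κ vᵀXv - 2vᵀy > 0. For X > 0 write y =
Xk: then A + Bkᵀ is similar to a skew-symmetric matrix, so X = ZZ* where the columns of Z are
eigenvectors for imaginary eigenvalues jω. Each column is a multiple u G(jω) and contributes -|u|² f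
≤ 0, a contradiction. Adding a small multiple of the controllability Gramian reduces X ≥ 0 to this
case.

Positivity of Q is Cauchy–Schwarz, and P > 0 then follows from Lyapunov theory, obtained here from
the Cayley transform. If adding vvᵀ did not raise the minimal eigenvalue of Q, some eigenvector
would be orthogonal to v; the inequality there gives Q ≥ ϑI, hence f(ω, 0, ϑ, v) ≥ 0 for all ω. -/

namespace StaticAdaptation

open Matrix Filter Topology

/-! ### Consequences of controllability -/

section Controllability

variable {n : ℕ} {A : Matrix (Fin n) (Fin n) ℝ} {B : Fin n → ℝ}

/-- A vector orthogonal to all `A ^ k B` vanishes if `(A, B)` is controllable. -/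
theorem IsControllable.eq_zero_of_orthogonal (h : IsControllable A B) {w : Fin n → ℝ}
    (hw : ∀ k : ℕ, w ⬝ᵥ ((A ^ k) *ᵥ B) = 0) : w = 0 := by
  have hsurj : Function.Surjective (controllabilityMatrix A B).mulVecLin := by
    rw [← LinearMap.range_eq_top]
    apply Submodule.eq_top_of_finrank_eq
    rw [show Module.finrank ℝ (LinearMap.range (controllabilityMatrix A B).mulVecLin) = n from h]
    simp
  obtain ⟨z, hz⟩ := hsurj w
  have h0 : w ᵥ* controllabilityMatrix A B = 0 := by
    ext k
    exact hw k
  rw [← dotProduct_self_eq_zero]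
  nth_rw 2 [← hz]
  rw [mulVecLin_apply, dotProduct_mulVec, h0, zero_dotProduct]

theorem IsControllable.matrix_eq_zero (h : IsControllable A B) {P : Matrix (Fin n) (Fin n) ℝ}
    (hP : ∀ k : ℕ, P *ᵥ ((A ^ k) *ᵥ B) = 0) : P = 0 := by
  ext i j
  have : P i = 0 := h.eq_zero_of_orthogonal fun k => congrFun (hP k) i
  rw [this]
  rfl

theorem IsControllable.ne_zero (h : IsControllable A B) (hn : 0 < n) : B ≠ 0 := by
  rintro rfl
  have : (Pi.single ⟨0, hn⟩ 1 : Fin n → ℝ) = 0 := h.eq_zero_of_orthogonal fun k => by simp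
  simpa using congrFun this ⟨0, hn⟩

end Controllability

/-! ### Real quadratic forms -/

section Quadratic

variable {n : ℕ}

theorem posSemidef_iff_real {M : Matrix (Fin n) (Fin n) ℝ} :
    M.PosSemidef ↔ M.IsSymm ∧ ∀ x : Fin n → ℝ, 0 ≤ x ⬝ᵥ (M *ᵥ x) := by
  rw [posSemidef_iff_dotProduct_mulVec]
  simp [IsHermitian, IsSymm]

theorem posDef_iff_real {M : Matrix (Fin n) (Fin n) ℝ} :
    M.PosDef ↔ M.IsSymm ∧ ∀ x : Fin n → ℝ, x ≠ 0 → 0 < x ⬝ᵥ (M *ᵥ x) := by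
  rw [posDef_iff_dotProduct_mulVec]
  simp [IsHermitian, IsSymm]

theorem dotProduct_mulVec_symm {M : Matrix (Fin n) (Fin n) ℝ} (hM : M.IsSymm) (x y : Fin n → ℝ) :
    x ⬝ᵥ (M *ᵥ y) = y ⬝ᵥ (M *ᵥ x) := by
  rw [dotProduct_mulVec, ← mulVec_transpose, hM.eq, dotProduct_comm]

theorem mulVec_eq_zero_of_quadratic_eq_zero {M : Matrix (Fin n) (Fin n) ℝ} (hM : M.PosSemidef)
    {x : Fin n → ℝ} (hx : x ⬝ᵥ (M *ᵥ x) = 0) : M *ᵥ x = 0 :=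
  (hM.dotProduct_mulVec_zero_iff x).1 (by simpa using hx)

theorem dotProduct_transpose_mul_mulVec (A P : Matrix (Fin n) (Fin n) ℝ) (x y : Fin n → ℝ) :
    x ⬝ᵥ ((Aᵀ * P) *ᵥ y) = (A *ᵥ x) ⬝ᵥ (P *ᵥ y) := by
  rw [← mulVec_mulVec, dotProduct_mulVec, ← mulVec_transpose, transpose_transpose]

theorem quadratic_lyapunov {P : Matrix (Fin n) (Fin n) ℝ} (hP : P.IsSymm)
    (A : Matrix (Fin n) (Fin n) ℝ) (x : Fin n → ℝ) :
    x ⬝ᵥ ((Aᵀ * P + P * A) *ᵥ x) = 2 * (x ⬝ᵥ (P *ᵥ (A *ᵥ x))) := by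
  rw [add_mulVec, dotProduct_add, dotProduct_transpose_mul_mulVec,
    dotProduct_mulVec_symm hP, mulVec_mulVec]
  ring

end Quadratic

/-! ### Powers of matrices with spectrum in the open unit disc -/

section PowTendsto

/-- Gelfand's formula: for r strictly between the spectral radius and 1, eventually ‖a ^ k‖ < r ^ k.
-/
theorem tendsto_pow_of_spectrum_lt_one {R : Type*} [NormedRing R] [NormedAlgebra ℂ R]
    [CompleteSpace R] [Nontrivial R] (a : R) (ha : ∀ z ∈ spectrum ℂ a, ‖z‖₊ < 1) :
    Tendsto (fun k : ℕ => a ^ k) atTop (𝓝 0) := by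
  have h1 : spectralRadius ℂ a < 1 := by
    simpa using spectrum.spectralRadius_lt_of_forall_lt a ha
  obtain ⟨r, hr1, hr2⟩ := ENNReal.lt_iff_exists_nnreal_btwn.1 h1
  have hr2' : r < 1 := by simpa using hr2
  have h2 := (spectrum.pow_nnnorm_pow_one_div_tendsto_nhds_spectralRadius a).eventually_lt_const hr1
  rw [tendsto_zero_iff_norm_tendsto_zero]
  refine squeeze_zero' (Eventually.of_forall fun _ => norm_nonneg _) ?_
    (tendsto_pow_atTop_nhds_zero_of_lt_one r.2 hr2')
  filter_upwards [h2, eventually_gt_atTop 0] with k hk hk0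
  have hk0' : (0 : ℝ) < k := by exact_mod_cast hk0
  have h3 := ENNReal.rpow_lt_rpow hk hk0'
  rw [← ENNReal.rpow_mul, one_div, inv_mul_cancel₀ hk0'.ne', ENNReal.rpow_one,
    ENNReal.rpow_natCast] at h3
  have h4 : ‖a ^ k‖₊ < r ^ k := by exact_mod_cast h3
  exact_mod_cast h4.le

theorem matrix_tendsto_pow_of_spectrum_lt_one {n : ℕ} (C : Matrix (Fin n) (Fin n) ℂ)
    (hC : ∀ z ∈ spectrum ℂ C, ‖z‖ < 1) :
    Tendsto (fun k : ℕ => C ^ k) atTop (𝓝 0) := by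
  rcases subsingleton_or_nontrivial (Matrix (Fin n) (Fin n) ℂ) with hs | hs
  · have : (fun k : ℕ => C ^ k) = fun _ => 0 := funext fun k => Subsingleton.elim _ _
    rw [this]
    exact tendsto_const_nhds
  · let : NormedRing (Matrix (Fin n) (Fin n) ℂ) := Matrix.linftyOpNormedRing
    let : NormedAlgebra ℂ (Matrix (Fin n) (Fin n) ℂ) := Matrix.linftyOpNormedAlgebra
    have : CompleteSpace (Matrix (Fin n) (Fin n) ℂ) := FiniteDimensional.complete ℂ _
    exact tendsto_pow_of_spectrum_lt_one C fun z hz => by exact_mod_cast hC z hz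

end PowTendsto

/-! ### Cayley transform of a Hurwitz matrix -/

section Cayley

variable {n : ℕ} {A : Matrix (Fin n) (Fin n) ℝ}

theorem IsHurwitz.isUnit_sub (hA : IsHurwitz A) {s : ℂ} (hs : 0 ≤ s.re) :
    IsUnit (s • (1 : Matrix (Fin n) (Fin n) ℂ) - A.map Complex.ofReal) := by
  by_contra h
  have : s ∈ spectrum ℂ (A.map Complex.ofReal) := by
    rw [spectrum.mem_iff, Algebra.algebraMap_eq_smul_one]
    exact h
  exact absurd (hA s this) (not_lt.2 hs)

theorem map_ofReal_isUnit_iff (M : Matrix (Fin n) (Fin n) ℝ) :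
    IsUnit (M.map Complex.ofReal) ↔ IsUnit M := by
  rw [isUnit_iff_isUnit_det, isUnit_iff_isUnit_det, isUnit_iff_ne_zero, isUnit_iff_ne_zero]
  have : (M.map Complex.ofReal).det = ((M.det : ℝ) : ℂ) :=
    (RingHom.map_det Complex.ofRealHom M).symm
  rw [this]
  simp

theorem IsHurwitz.isUnit_one_sub (hA : IsHurwitz A) : IsUnit (1 - A) := by
  rw [← map_ofReal_isUnit_iff]
  have := hA.isUnit_sub (s := 1) (by simp)
  rw [one_smul] at this
  rwa [Matrix.map_sub Complex.ofReal Complex.ofReal_sub,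
    Matrix.map_one Complex.ofReal Complex.ofReal_zero Complex.ofReal_one]

/-- The real part of (z - 1)/(z + 1) is (|z|² - 1)/|z + 1|². -/
theorem norm_lt_one_of_cayley {z : ℂ} (hz : z + 1 ≠ 0) (h : ((z - 1) / (z + 1)).re < 0) :
    ‖z‖ < 1 := by
  have hpos : 0 < Complex.normSq (z + 1) := Complex.normSq_pos.2 hz
  rw [Complex.div_re, ← add_div, div_lt_iff₀ hpos, zero_mul] at h
  simp only [Complex.sub_re, Complex.add_re, Complex.one_re, Complex.sub_im, Complex.add_im,
    Complex.one_im] at h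
  have h2 : Complex.normSq z < 1 := by
    rw [Complex.normSq_apply]
    nlinarith
  rw [Complex.normSq_eq_norm_sq] at h2
  nlinarith [norm_nonneg z]

/-- The Cayley transform of a Hurwitz matrix is a power-stable matrix. -/
theorem IsHurwitz.exists_cayley (hA : IsHurwitz A) :
    ∃ C : Matrix (Fin n) (Fin n) ℝ, C * (1 - A) = 1 + A ∧ (1 - A) * C = 1 + A ∧
      Tendsto (fun k : ℕ => C ^ k) atTop (𝓝 0) := by
  have hu := hA.isUnit_one_sub
  have hd : IsUnit (1 - A).det := (isUnit_iff_isUnit_det _).1 hu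
  have h1 : (1 + A) * (1 - A)⁻¹ * (1 - A) = 1 + A := nonsing_inv_mul_cancel_right _ _ hd
  refine ⟨(1 + A) * (1 - A)⁻¹, h1, ?_, ?_⟩
  · rw [← mul_assoc, show (1 - A) * (1 + A) = (1 + A) * (1 - A) by noncomm_ring,
      mul_nonsing_inv_cancel_right _ _ hd]
  · set C := (1 + A) * (1 - A)⁻¹ with hC
    set c : Matrix (Fin n) (Fin n) ℝ →+* Matrix (Fin n) (Fin n) ℂ :=
      Complex.ofRealHom.mapMatrix with hc
    have hcA : c A = A.map Complex.ofReal := rfl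
    have hlim : Tendsto (fun k : ℕ => (c C) ^ k) atTop (𝓝 0) := by
      apply matrix_tendsto_pow_of_spectrum_lt_one
      intro z hz
      have h2 : c C * (1 - c A) = 1 + c A := by
        rw [← map_one c, ← map_sub, ← map_mul, h1, map_add]
      -- If z is in the spectrum of C, the right-hand side is singular. This excludes z = -1, which
      -- would leave -2I, and otherwise makes (z - 1)/(z + 1) an eigenvalue of A.
      have h3 : (z • 1 - c C) * (1 - c A) = (z - 1) • 1 - (z + 1) • c A := by
        rw [sub_mul, h2, smul_mul_assoc, one_mul, smul_sub, sub_smul, add_smul, one_smul,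
          one_smul]
        abel
      have hu' : IsUnit (1 - c A) := by
        rw [← map_one c, ← map_sub]
        exact hu.map c
      have hnot : ¬ IsUnit ((z - 1) • 1 - (z + 1) • c A) := by
        rw [← h3]
        intro h
        rw [spectrum.mem_iff, Algebra.algebraMap_eq_smul_one] at hz
        obtain ⟨u, hu⟩ := hu'
        rw [← hu] at h
        exact hz ((Units.isUnit_mul_units _ u).1 h)
      have hz1 : z + 1 ≠ 0 := by
        intro h0
        apply hnot
        rw [h0, zero_smul, sub_zero, show z - 1 = -2 by linear_combination h0]
        exact (isUnit_one (M := Matrix (Fin n) (Fin n) ℂ)).smul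
          (Units.mk0 (-2 : ℂ) (by norm_num))
      apply norm_lt_one_of_cayley hz1
      apply hA
      rw [spectrum.mem_iff, Algebra.algebraMap_eq_smul_one]
      intro h
      apply hnot
      have : (z - 1) • 1 - (z + 1) • c A = (z + 1) • (((z - 1) / (z + 1)) • 1 - c A) := by
        rw [smul_sub, smul_smul, mul_div_cancel₀ _ hz1]
      rw [this]
      exact h.smul (Units.mk0 _ hz1)
    have hre : Continuous fun M : Matrix (Fin n) (Fin n) ℂ => M.map Complex.re :=
      continuous_id.matrix_map Complex.continuous_re
    have hlim' := (hre.tendsto 0).comp hlim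
    rw [Matrix.map_zero _ Complex.zero_re] at hlim'
    refine hlim'.congr fun k => ?_
    rw [Function.comp_apply, ← map_pow]
    ext i j
    simp [hc]

end Cayley

/-! ### Lyapunov equations and the controllability Gramian -/

section Lyapunov

variable {n : ℕ} {A : Matrix (Fin n) (Fin n) ℝ}

/-- Solutions of the Lyapunov inequality for a Hurwitz matrix are positive semidefinite. -/
theorem IsHurwitz.posSemidef_of_lyapunov (hA : IsHurwitz A) {P : Matrix (Fin n) (Fin n) ℝ}
    (hP : P.IsSymm) (hQ : ∀ x : Fin n → ℝ, x ⬝ᵥ ((Aᵀ * P + P * A) *ᵥ x) ≤ 0) :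
    P.PosSemidef := by
  obtain ⟨C, hC1, -, hC2⟩ := hA.exists_cayley
  rw [posSemidef_iff_real]
  refine ⟨hP, fun x => ?_⟩
  -- With y = (1 - A)z and Cy = (1 + A)z, the two values differ by 4 zᵀPAz = 2 zᵀ(AᵀP + PA)z ≤ 0.
  -- Iterating and letting C ^ k → 0 gives 0 ≤ xᵀPx.
  have hstep : ∀ y : Fin n → ℝ, (C *ᵥ y) ⬝ᵥ (P *ᵥ (C *ᵥ y)) ≤ y ⬝ᵥ (P *ᵥ y) := by
    intro y
    obtain ⟨z, rfl⟩ := mulVec_surjective_iff_isUnit.2 hA.isUnit_one_sub y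
    have hz := hQ z
    rw [quadratic_lyapunov hP] at hz
    have hs := dotProduct_mulVec_symm hP z (A *ᵥ z)
    rw [mulVec_mulVec, hC1]
    simp only [sub_mulVec, add_mulVec, one_mulVec, mulVec_sub, mulVec_add, dotProduct_sub,
      dotProduct_add, sub_dotProduct, add_dotProduct]
    linarith
  have hk : ∀ k : ℕ, ((C ^ k) *ᵥ x) ⬝ᵥ (P *ᵥ ((C ^ k) *ᵥ x)) ≤ x ⬝ᵥ (P *ᵥ x) := by
    intro k
    induction k with
    | zero => simp
    | succ k ih =>
      refine le_trans ?_ ih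
      rw [pow_succ', ← mulVec_mulVec]
      exact hstep _
  have hcont : Continuous fun M : Matrix (Fin n) (Fin n) ℝ => (M *ᵥ x) ⬝ᵥ (P *ᵥ (M *ᵥ x)) := by
    fun_prop
  have hlim := (hcont.tendsto 0).comp hC2
  simp only [zero_mulVec, zero_dotProduct] at hlim
  exact le_of_tendsto' hlim hk

/-- The Cayley transform turns the equation into X = C X Cᵀ, and iterating it sends the right-hand
side to 0. -/
theorem IsHurwitz.eq_zero_of_lyapunov_eq_zero (hA : IsHurwitz A) {X : Matrix (Fin n) (Fin n) ℝ}
    (hX : A * X + X * Aᵀ = 0) : X = 0 := by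
  obtain ⟨C, hC1, hC2, hC⟩ := hA.exists_cayley
  have hu := hA.isUnit_one_sub
  have hstep : X = C * X * Cᵀ := by
    have h1 : (1 - A) * X * (1 - A)ᵀ = (1 - A) * (C * X * Cᵀ) * (1 - A)ᵀ := by
      have : (1 - A) * (C * X * Cᵀ) * (1 - A)ᵀ = ((1 - A) * C) * X * ((1 - A) * C)ᵀ := by
        rw [transpose_mul]
        noncomm_ring
      rw [this, hC2, transpose_sub, transpose_add, transpose_one]
      have h2 : (1 + A) * X * (1 + Aᵀ) - (1 - A) * X * (1 - Aᵀ) = 2 • (A * X + X * Aᵀ) := by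
        noncomm_ring
      rw [hX, smul_zero, sub_eq_zero] at h2
      exact h2.symm
    have hut : IsUnit (1 - A)ᵀ := by rwa [isUnit_transpose]
    exact hu.mul_left_cancel (hut.mul_right_cancel h1)
  have hk : ∀ k : ℕ, C ^ k * X * (C ^ k)ᵀ = X := by
    intro k
    induction k with
    | zero => simp
    | succ k ih =>
      rw [pow_succ, transpose_mul]
      calc C ^ k * C * X * (Cᵀ * (C ^ k)ᵀ) = C ^ k * (C * X * Cᵀ) * (C ^ k)ᵀ := by noncomm_ring
        _ = X := by rw [← hstep, ih]
  have hcont : Continuous fun M : Matrix (Fin n) (Fin n) ℝ => M * X * Mᵀ := by fun_prop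
  have hlim := (hcont.tendsto 0).comp hC
  simp only [zero_mul] at hlim
  refine tendsto_nhds_unique (tendsto_const_nhds (x := X)) (hlim.congr fun k => ?_)
  exact hk k

theorem IsHurwitz.transpose (hA : IsHurwitz A) : IsHurwitz Aᵀ := by
  intro s hs
  apply hA s
  rw [spectrum.mem_iff, Algebra.algebraMap_eq_smul_one] at hs ⊢
  rwa [← isUnit_transpose, transpose_sub, transpose_smul, transpose_one, ← transpose_map]

/-- The controllability Gramian: the Lyapunov equation `A X + X Aᵀ = -B Bᵀ` has a positive
definite solution. -/
theorem exists_gramian (hA : IsHurwitz A) {B : Fin n → ℝ} (hAB : IsControllable A B) :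
    ∃ X : Matrix (Fin n) (Fin n) ℝ, X.PosDef ∧ A * X + X * Aᵀ = -vecMulVec B B := by
  let T : Matrix (Fin n) (Fin n) ℝ →ₗ[ℝ] Matrix (Fin n) (Fin n) ℝ :=
    LinearMap.mulLeft ℝ A + LinearMap.mulRight ℝ Aᵀ
  have hT : ∀ X, T X = A * X + X * Aᵀ := fun X => rfl
  have hinj : Function.Injective T := by
    rw [injective_iff_map_eq_zero]
    intro X hX
    exact hA.eq_zero_of_lyapunov_eq_zero hX
  obtain ⟨X, hX⟩ := LinearMap.injective_iff_surjective.1 hinj (-vecMulVec B B)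
  rw [hT] at hX
  -- Xᵀ solves the same equation, so uniqueness applies.
  have hsymm : X.IsSymm := by
    apply hinj
    rw [hT, hT, hX]
    have := congrArg Matrix.transpose hX
    rw [transpose_add, transpose_mul, transpose_mul, transpose_transpose, transpose_neg,
      transpose_vecMulVec] at this
    rw [← this, add_comm]
  have hquad : ∀ x : Fin n → ℝ, x ⬝ᵥ ((Aᵀᵀ * X + X * Aᵀ) *ᵥ x) = -(B ⬝ᵥ x) ^ 2 := by
    intro x
    rw [transpose_transpose, hX, neg_mulVec, dotProduct_neg, vecMulVec_mulVec]
    simp [dotProduct_comm x B, sq]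
  have hpsd : X.PosSemidef := hA.transpose.posSemidef_of_lyapunov hsymm fun x => by
    rw [hquad]
    nlinarith [sq_nonneg (B ⬝ᵥ x)]
  refine ⟨X, ?_, hX⟩
  rw [posDef_iff_real]
  refine ⟨hsymm, fun x hx => ?_⟩
  refine lt_of_le_of_ne ((posSemidef_iff_real.1 hpsd).2 x) fun h0 => hx ?_
  -- The kernel of X is Aᵀ-invariant and orthogonal to B, hence trivial by controllability.
  have hker : ∀ y : Fin n → ℝ, X *ᵥ y = 0 → B ⬝ᵥ y = 0 ∧ X *ᵥ (Aᵀ *ᵥ y) = 0 := by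
    intro y hy
    have h1 := hquad y
    rw [quadratic_lyapunov hsymm, dotProduct_mulVec_symm hsymm, hy, dotProduct_zero] at h1
    have h2 : B ⬝ᵥ y = 0 := by nlinarith
    refine ⟨h2, ?_⟩
    have h3 := congrArg (· *ᵥ y) hX
    simp only [add_mulVec, ← mulVec_mulVec, hy, mulVec_zero, zero_add, neg_mulVec,
      vecMulVec_mulVec, h2] at h3
    simpa using h3
  have hall : ∀ k : ℕ, X *ᵥ ((Aᵀ ^ k) *ᵥ x) = 0 := by
    intro k
    induction k with
    | zero => simpa using mulVec_eq_zero_of_quadratic_eq_zero hpsd h0.symm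
    | succ k ih =>
      rw [pow_succ', ← mulVec_mulVec]
      exact (hker _ ih).2
  apply hAB.eq_zero_of_orthogonal
  intro k
  have := (hker _ (hall k)).1
  rwa [← transpose_pow, mulVec_transpose, dotProduct_comm, ← dotProduct_mulVec] at this

end Lyapunov

/-! ### The transfer function and the necessity of the frequency inequality -/

section TransferFunction

variable {n : ℕ} {A : Matrix (Fin n) (Fin n) ℝ}

theorem euclNorm_sq {𝕜 : Type*} [RCLike 𝕜] (x : Fin n → 𝕜) :
    euclNorm x ^ 2 = ∑ i, ‖x i‖ ^ 2 := by
  simp [euclNorm, EuclideanSpace.norm_sq_eq]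

theorem euclNorm_sq_real (x : Fin n → ℝ) : euclNorm x ^ 2 = x ⬝ᵥ x := by
  rw [euclNorm_sq]
  simp [dotProduct, sq]

theorem euclNorm_sq_complex (x : Fin n → ℂ) :
    euclNorm x ^ 2 = (fun i => (x i).re) ⬝ᵥ (fun i => (x i).re) +
      (fun i => (x i).im) ⬝ᵥ (fun i => (x i).im) := by
  simp [euclNorm_sq, dotProduct, ← Finset.sum_add_distrib, ← Complex.normSq_eq_norm_sq,
    Complex.normSq_apply]

theorem euclNorm_sq_pos {𝕜 : Type*} [RCLike 𝕜] {x : Fin n → 𝕜} (hx : x ≠ 0) :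
    0 < euclNorm x ^ 2 := by
  have : 0 < euclNorm x := by simpa [euclNorm] using hx
  positivity

theorem re_ofReal_dotProduct (v : Fin n → ℝ) (x : Fin n → ℂ) :
    ((fun i => (v i : ℂ)) ⬝ᵥ x).re = v ⬝ᵥ fun i => (x i).re := by
  simp [dotProduct]

theorem im_ofReal_dotProduct (v : Fin n → ℝ) (x : Fin n → ℂ) :
    ((fun i => (v i : ℂ)) ⬝ᵥ x).im = v ⬝ᵥ fun i => (x i).im := by
  simp [dotProduct]

theorem IsHurwitz.mulVec_G (hA : IsHurwitz A) (B : Fin n → ℝ) {s : ℂ} (hs : 0 ≤ s.re) :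
    (s • (1 : Matrix (Fin n) (Fin n) ℂ) - A.map Complex.ofReal) *ᵥ G A B s =
      fun i => (B i : ℂ) := by
  rw [G, mulVec_mulVec, mul_nonsing_inv _ ((isUnit_iff_isUnit_det _).1 (hA.isUnit_sub hs)),
    one_mulVec]

theorem IsHurwitz.eq_smul_G (hA : IsHurwitz A) (B : Fin n → ℝ) {s : ℂ} (hs : 0 ≤ s.re)
    {z : Fin n → ℂ} {u : ℂ}
    (hz : (s • (1 : Matrix (Fin n) (Fin n) ℂ) - A.map Complex.ofReal) *ᵥ z =
      u • fun i => (B i : ℂ)) : z = u • G A B s := by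
  apply mulVec_injective_iff_isUnit.2 (hA.isUnit_sub hs)
  rw [hz, mulVec_smul, hA.mulVec_G B hs]

theorem IsHurwitz.smul_G (hA : IsHurwitz A) (B : Fin n → ℝ) {s : ℂ} (hs : 0 ≤ s.re) :
    s • G A B s = A.map Complex.ofReal *ᵥ G A B s + fun i => (B i : ℂ) := by
  rw [← hA.mulVec_G B hs, sub_mulVec, smul_mulVec, one_mulVec]
  abel

theorem IsHurwitz.G_ne_zero (hA : IsHurwitz A) {B : Fin n → ℝ} (hB : B ≠ 0) {s : ℂ}
    (hs : 0 ≤ s.re) : G A B s ≠ 0 := by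
  intro h
  apply hB
  have := hA.mulVec_G B hs
  rw [h, mulVec_zero] at this
  ext i
  simpa using (congrFun this i).symm

theorem re_map_mulVec (A : Matrix (Fin n) (Fin n) ℝ) (x : Fin n → ℂ) :
    (fun i => ((A.map Complex.ofReal *ᵥ x) i).re) = A *ᵥ fun i => (x i).re := by
  ext i
  exact re_ofReal_dotProduct (A i) x

theorem im_map_mulVec (A : Matrix (Fin n) (Fin n) ℝ) (x : Fin n → ℂ) :
    (fun i => ((A.map Complex.ofReal *ᵥ x) i).im) = A *ᵥ fun i => (x i).im := by
  ext i
  exact im_ofReal_dotProduct (A i) x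

theorem IsHurwitz.mulVec_re_G (hA : IsHurwitz A) (B : Fin n → ℝ) (ω : ℝ) :
    A *ᵥ (fun i => (G A B (Complex.I * ω) i).re) =
      -(ω • fun i => (G A B (Complex.I * ω) i).im) - B := by
  rw [← re_map_mulVec]
  have := hA.smul_G B (s := Complex.I * ω) (by simp)
  ext i
  have h := congrArg Complex.re (congrFun this i)
  simp at h
  simp
  linarith

theorem IsHurwitz.mulVec_im_G (hA : IsHurwitz A) (B : Fin n → ℝ) (ω : ℝ) :
    A *ᵥ (fun i => (G A B (Complex.I * ω) i).im) =
      ω • fun i => (G A B (Complex.I * ω) i).re := by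
  rw [← im_map_mulVec]
  have := hA.smul_G B (s := Complex.I * ω) (by simp)
  ext i
  have h := congrArg Complex.im (congrFun this i)
  simp at h
  simp
  linarith

theorem f_eq_re_im (A : Matrix (Fin n) (Fin n) ℝ) (B : Fin n → ℝ) (ω κ ϑ : ℝ) (v : Fin n → ℝ) :
    f A B ω κ ϑ v =
      2 * (v ⬝ᵥ fun i => (G A B (Complex.I * ω) i).re) +
        κ * ((v ⬝ᵥ fun i => (G A B (Complex.I * ω) i).re) ^ 2 +
          (v ⬝ᵥ fun i => (G A B (Complex.I * ω) i).im) ^ 2) -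
        ϑ * ((fun i => (G A B (Complex.I * ω) i).re) ⬝ᵥ (fun i => (G A B (Complex.I * ω) i).re) +
          (fun i => (G A B (Complex.I * ω) i).im) ⬝ᵥ (fun i => (G A B (Complex.I * ω) i).im)) := by
  rw [f, euclNorm_sq_complex, ← Complex.normSq_eq_norm_sq, Complex.normSq_apply,
    re_ofReal_dotProduct, im_ofReal_dotProduct]
  ring

/-- The frequency domain inequality follows from the linear matrix inequality. -/
theorem IsHurwitz.f_nonneg_of_lmi (hA : IsHurwitz A) {B v : Fin n → ℝ} {κ ϑ : ℝ}
    {P : Matrix (Fin n) (Fin n) ℝ} (hP : P.IsSymm) (hPB : P *ᵥ B = v)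
    (h : ∀ x : Fin n → ℝ, x ⬝ᵥ ((Aᵀ * P + P * A) *ᵥ x) + ϑ * (x ⬝ᵥ x) - κ * (v ⬝ᵥ x) ^ 2 ≤ 0)
    (ω : ℝ) : 0 ≤ f A B ω κ ϑ v := by
  rw [f_eq_re_im]
  set a := fun i => (G A B (Complex.I * ω) i).re with ha
  set b := fun i => (G A B (Complex.I * ω) i).im with hb
  -- The terms ±2ω aᵀPb cancel in the sum of the inequalities at a and b.
  have h1 := h a
  have h2 := h b
  rw [quadratic_lyapunov hP] at h1 h2
  rw [hA.mulVec_re_G B ω, mulVec_sub, hPB, mulVec_neg, mulVec_smul, dotProduct_sub,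
    dotProduct_neg, dotProduct_smul, smul_eq_mul, dotProduct_comm a v, ← hb] at h1
  rw [hA.mulVec_im_G B ω, mulVec_smul, dotProduct_smul, smul_eq_mul, ← ha,
    dotProduct_mulVec_symm hP] at h2
  linarith

end TransferFunction

/-! ### The dual inequality through imaginary eigenvectors -/

section FrequencyDecomposition

variable {n : ℕ} {A : Matrix (Fin n) (Fin n) ℝ}

/-- Since z = u G(jω), every term on the left scales by |u|². -/
theorem IsHurwitz.eigen_quadratic (hA : IsHurwitz A) {B v : Fin n → ℝ} (κ ϑ ω : ℝ)
    {z : Fin n → ℂ} {u : ℂ}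
    (hz : ((Complex.I * ω) • (1 : Matrix (Fin n) (Fin n) ℂ) - A.map Complex.ofReal) *ᵥ z =
      u • fun i => (B i : ℂ)) :
    ϑ * euclNorm z ^ 2 - κ * ‖(fun i => (v i : ℂ)) ⬝ᵥ z‖ ^ 2 -
      2 * (((fun i => (v i : ℂ)) ⬝ᵥ z) * star u).re = -(‖u‖ ^ 2 * f A B ω κ ϑ v) := by
  rw [hA.eq_smul_G B (by simp) hz, dotProduct_smul, f]
  have h1 : euclNorm (u • G A B (Complex.I * ω)) ^ 2 =
      ‖u‖ ^ 2 * euclNorm (G A B (Complex.I * ω)) ^ 2 := by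
    simp [euclNorm_sq, mul_pow, Finset.mul_sum]
  have h2 : ((u • ((fun i => (v i : ℂ)) ⬝ᵥ G A B (Complex.I * ω))) * star u).re =
      ‖u‖ ^ 2 * ((fun i => (v i : ℂ)) ⬝ᵥ G A B (Complex.I * ω)).re := by
    rw [smul_eq_mul, mul_right_comm, Complex.star_def, Complex.mul_conj,
      Complex.normSq_eq_norm_sq, Complex.re_ofReal_mul]
  rw [h1, h2, norm_smul]
  ring

theorem exists_eq_mul_transpose {X : Matrix (Fin n) (Fin n) ℝ} (hX : X.PosDef) :
    ∃ T : Matrix (Fin n) (Fin n) ℝ, IsUnit T ∧ X = T * Tᵀ := by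
  open scoped MatrixOrder in
  obtain ⟨S, hS⟩ := CStarAlgebra.nonneg_iff_eq_star_mul_self.mp hX.posSemidef.nonneg
  have hS' : X = Sᵀ * Sᵀᵀ := by
    rw [hS, transpose_transpose, star_eq_conjTranspose, conjTranspose_eq_transpose_of_trivial]
  refine ⟨Sᵀ, ?_, hS'⟩
  have := hX.isUnit
  rw [hS', isUnit_iff_isUnit_det, det_mul, IsUnit.mul_iff] at this
  exact (isUnit_iff_isUnit_det _).2 this.1

/-- If `Ac X + X Acᵀ = 0` with `X` positive definite, then `X = Z Zᴴ` for a complex matrix `Z`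
whose columns are eigenvectors of `Ac` for purely imaginary eigenvalues. -/
theorem exists_imaginary_eigenvector_factorization {X Ac : Matrix (Fin n) (Fin n) ℝ}
    (hX : X.PosDef) (h : Ac * X + X * Acᵀ = 0) :
    ∃ (Z : Matrix (Fin n) (Fin n) ℂ) (ω : Fin n → ℝ), X.map Complex.ofReal = Z * Zᴴ ∧
      ∀ j, Ac.map Complex.ofReal *ᵥ (fun i => Z i j) = (Complex.I * ω j) • fun i => Z i j := by
  obtain ⟨T, hT, rfl⟩ := exists_eq_mul_transpose hX
  have hTd : IsUnit T.det := (isUnit_iff_isUnit_det _).1 hT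
  set S := T⁻¹ * Ac * T with hS
  have hTS : T * S = Ac * T := by
    rw [hS, ← mul_assoc, ← mul_assoc, mul_nonsing_inv _ hTd, one_mul]
  -- T(S + Sᵀ)Tᵀ = Ac X + X Acᵀ = 0. So iS is Hermitian, and an eigenvalue λ of it gives the
  -- eigenvalue -iλ of S, whence ω = -λ.
  have hskew : S + Sᵀ = 0 := by
    have h1 : T * (S + Sᵀ) * Tᵀ = T * 0 * Tᵀ := by
      have : T * (S + Sᵀ) * Tᵀ = T * S * Tᵀ + T * (T * S)ᵀ := by
        rw [transpose_mul T S, mul_add, add_mul, mul_assoc T Sᵀ]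
      rw [this, hTS, transpose_mul, mul_zero, zero_mul, ← h]
      noncomm_ring
    have hTt : IsUnit Tᵀ := by rwa [isUnit_transpose]
    exact hT.mul_left_cancel (hTt.mul_right_cancel h1)
  have hH : (Complex.I • S.map Complex.ofReal).IsHermitian := by
    have h2 : Sᵀ = -S := by rw [eq_neg_iff_add_eq_zero, add_comm, hskew]
    ext i j
    have h3 : S j i = -S i j := congrFun (congrFun h2 i) j
    simp [h3]
  set c : Matrix (Fin n) (Fin n) ℝ →+* Matrix (Fin n) (Fin n) ℂ :=
    Complex.ofRealHom.mapMatrix with hc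
  have hcm : ∀ M, M.map Complex.ofReal = c M := fun _ => rfl
  have hct : ∀ M, c Mᵀ = (c M)ᴴ := by
    intro M
    ext i j
    simp [hc]
  set U : Matrix (Fin n) (Fin n) ℂ := (hH.eigenvectorUnitary : Matrix (Fin n) (Fin n) ℂ) with hU
  refine ⟨c T * U, fun j => -hH.eigenvalues j, ?_, fun j => ?_⟩
  · have hUU : U * Uᴴ = 1 := Unitary.coe_mul_star_self hH.eigenvectorUnitary
    rw [hcm, map_mul, hct, conjTranspose_mul, mul_assoc, ← mul_assoc U, hUU, one_mul]
  · have hcol : (fun i => (c T * U) i j) = c T *ᵥ (hH.eigenvectorBasis j).ofLp := by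
      ext i
      simp [mul_apply, mulVec, dotProduct, hU, IsHermitian.eigenvectorUnitary_apply]
    have heig := hH.mulVec_eigenvectorBasis j
    rw [smul_mulVec] at heig
    have heig' : c S *ᵥ (hH.eigenvectorBasis j).ofLp =
        (Complex.I * ((-hH.eigenvalues j : ℝ) : ℂ)) • (hH.eigenvectorBasis j).ofLp := by
      have := congrArg (fun w => (-Complex.I) • w) heig
      simp only [smul_smul, neg_mul, Complex.I_mul_I, neg_neg, one_smul] at this
      rw [← hcm, this]
      ext i
      simp [mul_assoc]
    rw [hcol, hcm, mulVec_mulVec, ← map_mul, ← hTS, map_mul, ← mulVec_mulVec, heig', mulVec_smul]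

theorem dotProduct_mulVec_eq_sum {X : Matrix (Fin n) (Fin n) ℝ} {Z : Matrix (Fin n) (Fin n) ℂ}
    (h : X.map Complex.ofReal = Z * Zᴴ) (p q : Fin n → ℝ) :
    p ⬝ᵥ (X *ᵥ q) = ∑ j, (((fun i => (p i : ℂ)) ⬝ᵥ fun i => Z i j) *
      star ((fun i => (q i : ℂ)) ⬝ᵥ fun i => Z i j)).re := by
  have h1 : ((p ⬝ᵥ (X *ᵥ q) : ℝ) : ℂ) =
      (fun i => (p i : ℂ)) ⬝ᵥ (X.map Complex.ofReal *ᵥ fun i => (q i : ℂ)) := by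
    simp [dotProduct, mulVec]
  rw [← Complex.ofReal_re (p ⬝ᵥ (X *ᵥ q)), h1, h, ← mulVec_mulVec, dotProduct_mulVec,
    ← Complex.re_sum]
  congr 1
  refine Finset.sum_congr rfl fun j _ => ?_
  congr 1
  simp [mulVec, dotProduct, mul_comm]

theorem re_mul_star_self (a : ℂ) : (a * star a).re = ‖a‖ ^ 2 := by
  rw [Complex.star_def, Complex.mul_conj, Complex.normSq_eq_norm_sq, Complex.ofReal_re]

theorem trace_eq_sum_euclNorm {X : Matrix (Fin n) (Fin n) ℝ} {Z : Matrix (Fin n) (Fin n) ℂ}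
    (h : X.map Complex.ofReal = Z * Zᴴ) :
    X.trace = ∑ j, euclNorm (fun i => Z i j) ^ 2 := by
  simp_rw [euclNorm_sq]
  rw [Finset.sum_comm, trace]
  refine Finset.sum_congr rfl fun i _ => ?_
  have := congrArg Complex.re (congrFun (congrFun h i) i)
  rw [map_apply, Complex.ofReal_re, mul_apply, Complex.re_sum] at this
  simpa only [conjTranspose_apply, re_mul_star_self, diag_apply] using this

/-- The dual inequality for positive definite multipliers. -/
theorem IsHurwitz.dual_inequality_of_posDef (hA : IsHurwitz A) {B v y : Fin n → ℝ} {κ ϑ : ℝ}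
    (hf : ∀ ω : ℝ, 0 ≤ f A B ω κ ϑ v) {X : Matrix (Fin n) (Fin n) ℝ} (hX : X.PosDef)
    (h : A * X + X * Aᵀ + vecMulVec B y + vecMulVec y B = 0) :
    ϑ * X.trace - κ * (v ⬝ᵥ (X *ᵥ v)) - 2 * (v ⬝ᵥ y) ≤ 0 := by
  have hXs : X.IsSymm := (posDef_iff_real.1 hX).1
  set k := X⁻¹ *ᵥ y with hk
  have hXk : X *ᵥ k = y := by
    rw [hk, mulVec_mulVec, mul_nonsing_inv _ ((isUnit_iff_isUnit_det _).1 hX.isUnit), one_mulVec]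
  have hkX : k ᵥ* X = y := by rw [← mulVec_transpose, hXs.eq, hXk]
  -- Substituting y = Xk absorbs the terms in y into a state feedback.
  have hAc : (A + vecMulVec B k) * X + X * (A + vecMulVec B k)ᵀ = 0 := by
    rw [transpose_add, transpose_vecMulVec, add_mul, mul_add, vecMulVec_mul, mul_vecMulVec,
      hkX, hXk, ← h]
    abel
  obtain ⟨Z, ω, hZ, hcol⟩ := exists_imaginary_eigenvector_factorization hX hAc
  rw [← hXk, trace_eq_sum_euclNorm hZ, dotProduct_mulVec_eq_sum hZ, dotProduct_mulVec_eq_sum hZ,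
    Finset.mul_sum, Finset.mul_sum, Finset.mul_sum, ← Finset.sum_sub_distrib,
    ← Finset.sum_sub_distrib]
  refine Finset.sum_nonpos fun j _ => ?_
  have hz : ((Complex.I * ω j) • (1 : Matrix (Fin n) (Fin n) ℂ) - A.map Complex.ofReal) *ᵥ
      (fun i => Z i j) = ((fun i => (k i : ℂ)) ⬝ᵥ fun i => Z i j) • fun i => (B i : ℂ) := by
    rw [sub_mulVec, smul_mulVec, one_mulVec, ← hcol j,
      Matrix.map_add Complex.ofReal Complex.ofReal_add, add_mulVec, add_sub_cancel_left]
    have : (vecMulVec B k).map Complex.ofReal =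
        vecMulVec (fun i => (B i : ℂ)) (fun i => (k i : ℂ)) := by
      ext i j
      simp [vecMulVec_apply]
    rw [this, vecMulVec_mulVec]
    ext i
    simp [mul_comm]
  have hq := hA.eigen_quadratic (v := v) κ ϑ (ω j) hz
  rw [re_mul_star_self, hq]
  have := hf (ω j)
  rw [neg_nonpos]
  positivity

/-- The dual inequality for positive semidefinite multipliers. -/
theorem IsHurwitz.dual_inequality (hA : IsHurwitz A) {B v y : Fin n → ℝ} {κ ϑ : ℝ}
    (hAB : IsControllable A B) (hf : ∀ ω : ℝ, 0 ≤ f A B ω κ ϑ v)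
    {X : Matrix (Fin n) (Fin n) ℝ} (hX : X.PosSemidef)
    (h : A * X + X * Aᵀ + vecMulVec B y + vecMulVec y B = 0) :
    ϑ * X.trace - κ * (v ⬝ᵥ (X *ᵥ v)) - 2 * (v ⬝ᵥ y) ≤ 0 := by
  obtain ⟨W, hW, hWB⟩ := exists_gramian hA hAB
  set c := ϑ * W.trace - κ * (v ⬝ᵥ (W *ᵥ v)) - v ⬝ᵥ B with hc
  have key : ∀ ε : ℝ, 0 < ε →
      (ϑ * X.trace - κ * (v ⬝ᵥ (X *ᵥ v)) - 2 * (v ⬝ᵥ y)) + ε * c ≤ 0 := by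
    intro ε hε
    -- Since AW + WAᵀ = -BBᵀ, shifting y by (ε/2)B compensates the shift of X by εW.
    have h1 := hA.dual_inequality_of_posDef hf (X := X + ε • W) (y := y + (ε / 2) • B)
      (PosDef.posSemidef_add hX (hW.smul hε)) ?_
    · rw [trace_add, trace_smul, add_mulVec, smul_mulVec, dotProduct_add, dotProduct_smul,
        dotProduct_add, dotProduct_smul] at h1
      simp only [smul_eq_mul] at h1
      rw [hc]
      linarith
    · have : A * (X + ε • W) + (X + ε • W) * Aᵀ + vecMulVec B (y + (ε / 2) • B) +
          vecMulVec (y + (ε / 2) • B) B =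
          (A * X + X * Aᵀ + vecMulVec B y + vecMulVec y B) +
            ε • (A * W + W * Aᵀ + vecMulVec B B) := by
        simp only [mul_add, add_mul, vecMulVec_add, add_vecMulVec, vecMulVec_smul,
          smul_vecMulVec, mul_smul_comm, smul_mul_assoc]
        module
      rw [this, h, hWB]
      simp
  have hlim : Tendsto (fun ε : ℝ => (ϑ * X.trace - κ * (v ⬝ᵥ (X *ᵥ v)) - 2 * (v ⬝ᵥ y)) + ε * c)
      (𝓝[>] 0) (𝓝 ((ϑ * X.trace - κ * (v ⬝ᵥ (X *ᵥ v)) - 2 * (v ⬝ᵥ y)) + 0 * c)) := by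
    apply Tendsto.mono_left _ nhdsWithin_le_nhds
    exact Continuous.tendsto (by fun_prop) 0
  rw [zero_mul, add_zero] at hlim
  refine le_of_tendsto hlim ?_
  filter_upwards [self_mem_nhdsWithin] with ε hε using key ε hε

end FrequencyDecomposition

/-! ### Linear images of closed cones -/

section ClosedCone

/-- A continuous linear map which is injective at `0` on a closed cone maps it to a closed set. -/
theorem isClosed_image_of_cone {E F : Type*} [NormedAddCommGroup E] [NormedSpace ℝ E]
    [ProperSpace E] [NormedAddCommGroup F] [NormedSpace ℝ F] (T : E →L[ℝ] F) {C : Set E}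
    (hC : IsClosed C) (hcone : ∀ c : ℝ, 0 < c → ∀ x ∈ C, c • x ∈ C)
    (hker : ∀ x ∈ C, T x = 0 → x = 0) : IsClosed (T '' C) := by
  -- Minimizing ‖T x‖ over the compact set of unit vectors of the cone gives c. Preimages of a
  -- convergent sequence are then bounded, so a subsequence converges.
  obtain ⟨c, hc, hbound⟩ : ∃ c : ℝ, 0 < c ∧ ∀ x ∈ C, c * ‖x‖ ≤ ‖T x‖ := by
    obtain ⟨c, hc, hs⟩ : ∃ c : ℝ, 0 < c ∧ ∀ x ∈ C ∩ Metric.sphere 0 1, c ≤ ‖T x‖ := by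
      rcases (C ∩ Metric.sphere (0 : E) 1).eq_empty_or_nonempty with he | hne
      · exact ⟨1, one_pos, by simp [he]⟩
      · obtain ⟨x₀, hx₀, hmin⟩ := ((isCompact_sphere (0 : E) 1).inter_left hC).exists_isMinOn hne
          (T.continuous.norm.continuousOn)
        refine ⟨‖T x₀‖, norm_pos_iff.2 fun h => ?_, fun x hx => hmin hx⟩
        have h1 := hx₀.2
        rw [hker x₀ hx₀.1 h] at h1
        simp at h1
    refine ⟨c, hc, fun x hx => ?_⟩
    rcases eq_or_ne x 0 with rfl | hx0
    · simp
    · have hn : 0 < ‖x‖ := norm_pos_iff.2 hx0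
      have h1 := hs (‖x‖⁻¹ • x) ⟨hcone _ (inv_pos.2 hn) x hx, by simp [norm_smul, hn.ne']⟩
      rw [map_smul, norm_smul, norm_inv, norm_norm, ← div_eq_inv_mul, le_div_iff₀ hn] at h1
      exact h1
  rw [← isSeqClosed_iff_isClosed]
  intro y l hy hl
  choose x hxC hxy using hy
  obtain ⟨R, hR⟩ := hl.norm.bddAbove_range
  have hxb : ∀ k, x k ∈ Metric.closedBall (0 : E) (R / c) := by
    intro k
    rw [mem_closedBall_zero_iff, le_div_iff₀ hc, mul_comm]
    refine (hbound _ (hxC k)).trans ?_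
    rw [hxy]
    exact hR ⟨k, rfl⟩
  obtain ⟨a, -, φ, hφ, hlim⟩ := (isCompact_closedBall (0 : E) (R / c)).tendsto_subseq hxb
  refine ⟨a, hC.mem_of_tendsto hlim (Eventually.of_forall fun k => hxC _), ?_⟩
  refine tendsto_nhds_unique ((T.continuous.tendsto a).comp hlim) ?_
  refine (hl.comp hφ.tendsto_atTop).congr fun k => ?_
  simp [hxy]

end ClosedCone

/-! ### The cone of the matrix inequality and the Kalman–Yakubovich–Popov lemma -/

section LMICone

variable {n : ℕ}

theorem isClosed_setOf_isSymm : IsClosed {M : Matrix (Fin n) (Fin n) ℝ | M.IsSymm} :=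
  isClosed_eq (by fun_prop) continuous_id

theorem isClosed_setOf_posSemidef : IsClosed {M : Matrix (Fin n) (Fin n) ℝ | M.PosSemidef} := by
  simp_rw [posSemidef_iff_real, Set.ofPred_and, Set.ofPred_forall]
  exact isClosed_setOf_isSymm.inter
    (isClosed_iInter fun x => isClosed_le continuous_const (by fun_prop))

/-- The linear map `(N, P) ↦ (N + Aᵀ P + P A, P B)`. -/
def lmiMap (A : Matrix (Fin n) (Fin n) ℝ) (B : Fin n → ℝ) :
    Matrix (Fin n) (Fin n) ℝ × Matrix (Fin n) (Fin n) ℝ →ₗ[ℝ]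
      Matrix (Fin n) (Fin n) ℝ × (Fin n → ℝ) where
  toFun q := (q.1 + (Aᵀ * q.2 + q.2 * A), q.2 *ᵥ B)
  map_add' p q := by
    simp only [Prod.fst_add, Prod.snd_add, Prod.mk_add_mk, mul_add, add_mul, add_mulVec]
    congr 1
    abel
  map_smul' c q := by
    simp [smul_add, smul_mulVec]

/-- The pairs `(N, P)` with `N` positive semidefinite and `P` symmetric. -/
def lmiDomain (n : ℕ) : Set (Matrix (Fin n) (Fin n) ℝ × Matrix (Fin n) (Fin n) ℝ) :=
  {q | q.1.PosSemidef ∧ q.2.IsSymm}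

theorem isClosed_lmiDomain : IsClosed (lmiDomain n) :=
  (isClosed_setOf_posSemidef.preimage continuous_fst).inter
    (isClosed_setOf_isSymm.preimage continuous_snd)

theorem smul_mem_lmiDomain {c : ℝ} (hc : 0 ≤ c)
    {q : Matrix (Fin n) (Fin n) ℝ × Matrix (Fin n) (Fin n) ℝ} (hq : q ∈ lmiDomain n) :
    c • q ∈ lmiDomain n :=
  ⟨hq.1.smul hc, hq.2.smul c⟩

theorem add_mem_lmiDomain {p q : Matrix (Fin n) (Fin n) ℝ × Matrix (Fin n) (Fin n) ℝ}
    (hp : p ∈ lmiDomain n) (hq : q ∈ lmiDomain n) : p + q ∈ lmiDomain n :=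
  ⟨hp.1.add hq.1, hp.2.add hq.2⟩

/-- If Pb = 0 then bᵀNb = 0, so Nb = 0 and the equation gives PAb = 0. Starting from b = B, this
makes P vanish on all A ^ k B. -/
theorem IsControllable.lmiMap_eq_zero {A : Matrix (Fin n) (Fin n) ℝ} {B : Fin n → ℝ}
    (hAB : IsControllable A B) {q : Matrix (Fin n) (Fin n) ℝ × Matrix (Fin n) (Fin n) ℝ}
    (hq : q ∈ lmiDomain n) (h : lmiMap A B q = 0) : q = 0 := by
  obtain ⟨N, P⟩ := q
  obtain ⟨hN, hP⟩ : N.PosSemidef ∧ P.IsSymm := hq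
  have h1 : N + (Aᵀ * P + P * A) = 0 := congrArg Prod.fst h
  have h2 : P *ᵥ B = 0 := congrArg Prod.snd h
  have hPk : ∀ k : ℕ, P *ᵥ ((A ^ k) *ᵥ B) = 0 := by
    intro k
    induction k with
    | zero => simpa using h2
    | succ k ih =>
      set b := (A ^ k) *ᵥ B with hb
      have h3 : b ⬝ᵥ (N *ᵥ b) = 0 := by
        have := congrArg (fun M => b ⬝ᵥ (M *ᵥ b)) h1
        simp only [add_mulVec N, dotProduct_add, quadratic_lyapunov hP, zero_mulVec,
          dotProduct_zero] at this
        rw [dotProduct_mulVec_symm hP, ih, dotProduct_zero] at this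
        linarith
      have h4 := mulVec_eq_zero_of_quadratic_eq_zero hN h3
      have h5 := congrArg (fun M => M *ᵥ b) h1
      simp only [add_mulVec, h4, ← mulVec_mulVec, ih, mulVec_zero, zero_add, zero_mulVec] at h5
      rw [pow_succ', ← mulVec_mulVec]
      exact h5
  have hP0 : P = 0 := hAB.matrix_eq_zero hPk
  subst hP0
  have : N = 0 := by simpa using h1
  rw [this]
  rfl

theorem IsControllable.isClosed_lmiMap_image {A : Matrix (Fin n) (Fin n) ℝ} {B : Fin n → ℝ}
    (hAB : IsControllable A B) : IsClosed (lmiMap A B '' lmiDomain n) := by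
  let : NormedAddCommGroup (Matrix (Fin n) (Fin n) ℝ) := Matrix.normedAddCommGroup
  let : NormedSpace ℝ (Matrix (Fin n) (Fin n) ℝ) := Matrix.normedSpace
  have : ProperSpace (Matrix (Fin n) (Fin n) ℝ) := FiniteDimensional.proper ℝ _
  exact isClosed_image_of_cone (LinearMap.toContinuousLinearMap (lmiMap A B)) isClosed_lmiDomain
    (fun c hc x hx => smul_mem_lmiDomain hc.le hx) fun x hx h => hAB.lmiMap_eq_zero hx h

theorem trace_mul_vecMulVec (X : Matrix (Fin n) (Fin n) ℝ) (x y : Fin n → ℝ) :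
    (X * vecMulVec x y).trace = y ⬝ᵥ (X *ᵥ x) := by
  rw [mul_vecMulVec, trace_vecMulVec, dotProduct_comm]

/-- The adjoint of `P ↦ (Aᵀ P + P A, P B)` with respect to the trace pairing. -/
theorem trace_dual_mul (A X : Matrix (Fin n) (Fin n) ℝ) (B y : Fin n → ℝ)
    {P : Matrix (Fin n) (Fin n) ℝ} (hP : P.IsSymm) :
    ((A * X + X * Aᵀ + vecMulVec B y + vecMulVec y B) * P).trace =
      (X * (Aᵀ * P + P * A)).trace + 2 * (y ⬝ᵥ (P *ᵥ B)) := by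
  rw [mul_add, trace_add, add_mul, add_mul, add_mul, trace_add, trace_add, trace_add,
    trace_mul_comm (vecMulVec B y), trace_mul_comm (vecMulVec y B), trace_mul_vecMulVec,
    trace_mul_vecMulVec, dotProduct_mulVec_symm hP B y, mul_assoc A, trace_mul_comm A,
    mul_assoc, mul_assoc]
  ring

/-- On pairs of a symmetric matrix and a vector, a linear functional has the form
`(M, w) ↦ tr (X M) + 2 yᵀ w` with `X` symmetric. -/
theorem exists_symm_representation
    (φ : Matrix (Fin n) (Fin n) ℝ × (Fin n → ℝ) →ₗ[ℝ] ℝ) :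
    ∃ (X : Matrix (Fin n) (Fin n) ℝ) (y : Fin n → ℝ), X.IsSymm ∧
      ∀ (M : Matrix (Fin n) (Fin n) ℝ) (w : Fin n → ℝ), M.IsSymm →
        φ (M, w) = (X * M).trace + 2 * (y ⬝ᵥ w) := by
  set Y : Matrix (Fin n) (Fin n) ℝ := Matrix.of fun i j => φ (Matrix.single i j 1, 0) with hY
  -- Symmetrizing Y does not change its trace pairing with symmetric M; halving y offsets the factor
  -- 2.
  refine ⟨(1 / 2 : ℝ) • (Y + Yᵀ), fun i => φ (0, Pi.single i 1) / 2, ?_, fun M w hM => ?_⟩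
  · rw [IsSymm, transpose_smul, transpose_add, transpose_transpose, add_comm]
  · have h1 : φ (M, w) = φ (M, 0) + φ (0, w) := by
      rw [← map_add]
      simp
    have h2 : φ (M, 0) = (Yᵀ * M).trace := by
      have : φ (M, 0) = (φ ∘ₗ LinearMap.inl ℝ _ _) M := rfl
      rw [this]
      conv_lhs => rw [matrix_eq_sum_single M]
      simp only [map_sum, trace, diag_apply, mul_apply, transpose_apply]
      rw [Finset.sum_comm]
      refine Finset.sum_congr rfl fun j _ => Finset.sum_congr rfl fun i _ => ?_
      have : Matrix.single i j (M i j) = M i j • Matrix.single i j (1 : ℝ) := by simp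
      rw [this, map_smul, smul_eq_mul, mul_comm]
      rfl
    have h3 : φ (0, w) = 2 * ((fun i => φ (0, Pi.single i 1) / 2) ⬝ᵥ w) := by
      have : φ (0, w) = (φ ∘ₗ LinearMap.inr ℝ _ _) w := rfl
      rw [this, LinearMap.pi_apply_eq_sum_univ, dotProduct, Finset.mul_sum]
      refine Finset.sum_congr rfl fun i _ => ?_
      have : (fun j => if i = j then (1 : ℝ) else 0) = Pi.single i 1 := by
        ext j
        simp [Pi.single_apply, eq_comm]
      rw [this, smul_eq_mul, LinearMap.comp_apply, LinearMap.inr_apply]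
      ring
    have h4 : (Y * M).trace = (Yᵀ * M).trace := by
      rw [← trace_transpose (Y * M), transpose_mul, hM.eq, trace_mul_comm]
    rw [h1, h2, h3, smul_mul_assoc, trace_smul, add_mul, trace_add, h4, smul_eq_mul]
    ring

/-- The Kalman–Yakubovich–Popov lemma, with an equality constraint `P B = v`. -/
theorem IsHurwitz.exists_lmi_solution {A : Matrix (Fin n) (Fin n) ℝ} (hA : IsHurwitz A)
    {B v : Fin n → ℝ} {κ ϑ : ℝ} (hAB : IsControllable A B)
    (hf : ∀ ω : ℝ, 0 ≤ f A B ω κ ϑ v) :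
    ∃ P : Matrix (Fin n) (Fin n) ℝ, P.IsSymm ∧ P *ᵥ B = v ∧
      (-(Aᵀ * P + P * A + ϑ • (1 : Matrix (Fin n) (Fin n) ℝ) - κ • vecMulVec v v)).PosSemidef := by
  have : LocallyConvexSpace ℝ (Matrix (Fin n) (Fin n) ℝ) :=
    inferInstanceAs (LocallyConvexSpace ℝ (Fin n → Fin n → ℝ))
  set N₀ : Matrix (Fin n) (Fin n) ℝ := ϑ • 1 - κ • vecMulVec v v with hN₀
  have hN₀s : N₀.IsSymm := by
    rw [IsSymm, hN₀, transpose_sub, transpose_smul, transpose_smul, transpose_one,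
      transpose_vecMulVec]
  set K := lmiMap A B '' lmiDomain n with hK
  have hclosed : IsClosed K := hAB.isClosed_lmiMap_image
  have hconv : Convex ℝ K := by
    apply Convex.linear_image
    intro x hx y hy a b ha hb _
    exact add_mem_lmiDomain (smul_mem_lmiDomain ha hx) (smul_mem_lmiDomain hb hy)
  by_cases hmem : (-N₀, v) ∈ K
  · obtain ⟨⟨N, P⟩, ⟨hN, hP⟩, hNP⟩ := hmem
    have h1 : N + (Aᵀ * P + P * A) = -N₀ := congrArg Prod.fst hNP
    refine ⟨P, hP, congrArg Prod.snd hNP, ?_⟩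
    have : -(Aᵀ * P + P * A + ϑ • (1 : Matrix (Fin n) (Fin n) ℝ) - κ • vecMulVec v v) = N := by
      rw [add_sub_assoc, ← hN₀, neg_eq_iff_add_eq_zero, ← neg_neg N₀, ← h1]
      abel
    rw [this]
    exact hN
  · exfalso
    obtain ⟨φ, u, hφK, hφ⟩ := geometric_hahn_banach_closed_point hconv hclosed hmem
    -- A functional bounded above on a cone is nonpositive there.
    have hneg : ∀ q ∈ lmiDomain n, φ (lmiMap A B q) ≤ 0 := by
      intro q hq
      by_contra! hpos
      obtain ⟨k, hk⟩ := exists_nat_gt (u / φ (lmiMap A B q))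
      have h1 := hφK _ ⟨_, smul_mem_lmiDomain k.cast_nonneg hq, rfl⟩
      rw [map_smul, map_smul, smul_eq_mul] at h1
      rw [div_lt_iff₀ hpos] at hk
      linarith
    have hu : 0 < u := by
      simpa using hφK _ ⟨0, ⟨PosSemidef.zero, isSymm_zero⟩, rfl⟩
    obtain ⟨X, y, hX, hrep⟩ := exists_symm_representation (-φ.toLinearMap)
    simp only [LinearMap.neg_apply, ContinuousLinearMap.coe_coe] at hrep
    have hXpsd : X.PosSemidef := by
      rw [posSemidef_iff_real]
      refine ⟨hX, fun x => ?_⟩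
      have hxx : (vecMulVec x x).PosSemidef := by
        simpa using posSemidef_vecMulVec_self_star x
      have h1 := hneg (vecMulVec x x, 0) ⟨hxx, isSymm_zero⟩
      have h2 := hrep (vecMulVec x x) 0 (posSemidef_iff_real.1 hxx).1
      have h3 : lmiMap A B (vecMulVec x x, 0) = (vecMulVec x x, 0) := by simp [lmiMap]
      rw [h3] at h1
      rw [trace_mul_vecMulVec, dotProduct_zero] at h2
      linarith
    set S := A * X + X * Aᵀ + vecMulVec B y + vecMulVec y B with hS
    have hSs : S.IsSymm := by
      rw [IsSymm, hS]
      simp only [transpose_add, transpose_mul, transpose_vecMulVec, transpose_transpose, hX.eq]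
      abel
    have hLs : (Aᵀ * S + S * A).IsSymm := by
      rw [IsSymm, transpose_add, transpose_mul, transpose_mul, transpose_transpose, hSs.eq,
        add_comm]
    -- P ranges over a linear space, so both S and -S are admissible. Testing with P = S itself
    -- turns the adjoint identity into tr(S²) = 0.
    have hzero : φ (lmiMap A B (0, S)) = 0 := by
      apply le_antisymm (hneg _ ⟨PosSemidef.zero, hSs⟩)
      have h1 := hneg (0, -S) ⟨PosSemidef.zero, hSs.neg⟩
      have h2 : ((0, -S) : Matrix (Fin n) (Fin n) ℝ × Matrix (Fin n) (Fin n) ℝ) = -(0, S) := by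
        simp
      rw [h2, map_neg, map_neg] at h1
      linarith
    have htr : (Sᴴ * S).trace = 0 := by
      have h1 := hrep (Aᵀ * S + S * A) (S *ᵥ B) hLs
      have h2 : lmiMap A B (0, S) = (Aᵀ * S + S * A, S *ᵥ B) := by simp [lmiMap]
      rw [← h2, hzero, neg_zero] at h1
      rw [conjTranspose_eq_transpose_of_trivial, hSs.eq]
      exact (trace_dual_mul A X B y hSs).trans h1.symm
    have hS0 : S = 0 := trace_conjTranspose_mul_self_eq_zero_iff.1 htr
    have hdual := hA.dual_inequality hAB hf hXpsd hS0
    -- This makes φ(-N₀, v) the left-hand side of the dual inequality, hence nonpositive, although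
    -- it exceeds u > 0.
    have h1 := hrep (-N₀) v hN₀s.neg
    rw [mul_neg, trace_neg, hN₀, mul_sub, mul_smul_comm, mul_smul_comm, mul_one, trace_sub,
      trace_smul, trace_smul, trace_mul_vecMulVec, smul_eq_mul, smul_eq_mul,
      dotProduct_comm y v, ← hN₀] at h1
    linarith

end LMICone

/-! ### Continuity and high-frequency limits -/

section HighFrequency

variable {n : ℕ} {A : Matrix (Fin n) (Fin n) ℝ}

theorem continuousAt_matrix_inv {α : Type*} [TopologicalSpace α]
    {M : α → Matrix (Fin n) (Fin n) ℂ} {x : α} (hM : ContinuousAt M x) (hx : IsUnit (M x)) :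
    ContinuousAt (fun y => (M y)⁻¹) x := by
  have hd : (M x).det ≠ 0 := isUnit_iff_ne_zero.1 ((isUnit_iff_isUnit_det _).1 hx)
  simp_rw [inv_def, Ring.inverse_eq_inv']
  have hdet : ContinuousAt (fun y => (M y).det) x :=
    (continuous_id.matrix_det.continuousAt).comp hM
  have hadj : ContinuousAt (fun y => (M y).adjugate) x :=
    (continuous_id.matrix_adjugate.continuousAt).comp hM
  exact (hdet.inv₀ hd).smul hadj

theorem IsHurwitz.continuous_G (hA : IsHurwitz A) (B : Fin n → ℝ) :
    Continuous fun ω : ℝ => G A B (Complex.I * ω) := by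
  rw [continuous_iff_continuousAt]
  intro ω
  have hinv : ContinuousAt (fun ω : ℝ => ((Complex.I * ω) • (1 : Matrix (Fin n) (Fin n) ℂ) -
      A.map Complex.ofReal)⁻¹) ω :=
    continuousAt_matrix_inv (Continuous.continuousAt (by fun_prop)) (hA.isUnit_sub (by simp))
  have hmul : Continuous fun M : Matrix (Fin n) (Fin n) ℂ => M *ᵥ fun i => (B i : ℂ) := by
    fun_prop
  exact hmul.continuousAt.comp hinv

/-- With t = 1/s, sG(s) = (1 - tA)⁻¹B, which is continuous at t = 0. -/
theorem IsHurwitz.tendsto_smul_G (hA : IsHurwitz A) (B : Fin n → ℝ) :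
    Tendsto (fun ω : ℝ => (Complex.I * ω) • G A B (Complex.I * ω)) (cocompact ℝ)
      (𝓝 fun i => (B i : ℂ)) := by
  set W : ℂ → Fin n → ℂ := fun t => (1 - t • A.map Complex.ofReal)⁻¹ *ᵥ fun i => (B i : ℂ)
    with hW
  have hW0 : W 0 = fun i => (B i : ℂ) := by simp [hW]
  have hcont : ContinuousAt W 0 := by
    have hinv : ContinuousAt (fun t : ℂ => (1 - t • A.map Complex.ofReal)⁻¹) 0 :=
      continuousAt_matrix_inv (Continuous.continuousAt (by fun_prop)) (by simp)
    have hmul : Continuous fun M : Matrix (Fin n) (Fin n) ℂ => M *ᵥ fun i => (B i : ℂ) := by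
      fun_prop
    exact hmul.continuousAt.comp hinv
  have hinv : Tendsto (fun ω : ℝ => (Complex.I * ω)⁻¹) (cocompact ℝ) (𝓝 0) := by
    rw [tendsto_zero_iff_norm_tendsto_zero]
    have : (fun ω : ℝ => ‖(Complex.I * ω)⁻¹‖) = fun ω : ℝ => ‖ω‖⁻¹ := by
      ext ω
      simp
    rw [this]
    exact tendsto_norm_cocompact_atTop.inv_tendsto_atTop
  have hlim := hcont.tendsto.comp hinv
  rw [hW0] at hlim
  refine hlim.congr' ?_
  have hne : ∀ᶠ ω : ℝ in cocompact ℝ, ω ≠ 0 := by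
    filter_upwards [tendsto_norm_cocompact_atTop.eventually_gt_atTop (0 : ℝ)] with ω hω
    exact norm_pos_iff.1 hω
  filter_upwards [hne] with ω hω
  have hs : Complex.I * (ω : ℂ) ≠ 0 := mul_ne_zero Complex.I_ne_zero (by exact_mod_cast hω)
  have hu := hA.isUnit_sub (s := Complex.I * ω) (by simp)
  have heq : (1 : Matrix (Fin n) (Fin n) ℂ) - (Complex.I * ω)⁻¹ • A.map Complex.ofReal =
      (Complex.I * ω)⁻¹ • ((Complex.I * ω) • 1 - A.map Complex.ofReal) := by
    rw [smul_sub, smul_smul, inv_mul_cancel₀ hs, one_smul]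
  have hu' : IsUnit ((1 : Matrix (Fin n) (Fin n) ℂ) - (Complex.I * ω)⁻¹ • A.map Complex.ofReal) := by
    rw [heq]
    exact hu.smul (Units.mk0 _ (inv_ne_zero hs))
  apply mulVec_injective_iff_isUnit.2 hu'
  change _ *ᵥ (_ *ᵥ _) = _
  rw [mulVec_mulVec, mul_nonsing_inv _ ((isUnit_iff_isUnit_det _).1 hu'), one_mulVec, heq,
    smul_mulVec, mulVec_smul, smul_smul, inv_mul_cancel₀ hs, one_smul, hA.mulVec_G B (by simp)]

theorem IsHurwitz.tendsto_smul_re_G (hA : IsHurwitz A) (B : Fin n → ℝ) :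
    Tendsto (fun ω : ℝ => ω • fun i => (G A B (Complex.I * ω) i).re) (cocompact ℝ) (𝓝 0) := by
  rw [tendsto_pi_nhds]
  intro i
  have h := (Complex.continuous_im.tendsto _).comp ((tendsto_pi_nhds.1 (hA.tendsto_smul_G B)) i)
  simpa [Function.comp_def] using h

theorem IsHurwitz.tendsto_smul_im_G (hA : IsHurwitz A) (B : Fin n → ℝ) :
    Tendsto (fun ω : ℝ => ω • fun i => (G A B (Complex.I * ω) i).im) (cocompact ℝ) (𝓝 (-B)) := by
  rw [tendsto_pi_nhds]
  intro i
  have h := ((Complex.continuous_re.tendsto _).comp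
    ((tendsto_pi_nhds.1 (hA.tendsto_smul_G B)) i)).neg
  simpa [Function.comp_def] using h

/-- The normalized frequency function has a limit as `|ω| → ∞`. -/
theorem IsHurwitz.exists_tendsto_ratio (hA : IsHurwitz A) {B : Fin n → ℝ} (hB : B ≠ 0)
    (κ ϑ : ℝ) (v : Fin n → ℝ) :
    ∃ L : ℝ, Tendsto (fun ω : ℝ => (euclNorm (G A B (Complex.I * ω)) ^ 2)⁻¹ * f A B ω κ ϑ v)
      (cocompact ℝ) (𝓝 L) := by
  set a : ℝ → Fin n → ℝ := fun ω i => (G A B (Complex.I * ω) i).re with ha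
  set b : ℝ → Fin n → ℝ := fun ω i => (G A B (Complex.I * ω) i).im with hb
  have hlima : Tendsto (fun ω => ω • a ω) (cocompact ℝ) (𝓝 0) := hA.tendsto_smul_re_G B
  have hlimb : Tendsto (fun ω => ω • b ω) (cocompact ℝ) (𝓝 (-B)) := hA.tendsto_smul_im_G B
  have hnorm : ∀ ω : ℝ, ω ^ 2 * euclNorm (G A B (Complex.I * ω)) ^ 2 =
      (ω • a ω) ⬝ᵥ (ω • a ω) + (ω • b ω) ⬝ᵥ (ω • b ω) := by
    intro ω
    rw [euclNorm_sq_complex]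
    simp only [smul_dotProduct, dotProduct_smul, smul_eq_mul, ha, hb]
    ring
  -- The identity A Im G = ω Re G rewrites ω² Re G as A(ω Im G), which converges.
  have hnum : ∀ ω : ℝ, ω ^ 2 * f A B ω κ ϑ v =
      2 * (v ⬝ᵥ (A *ᵥ (ω • b ω))) + κ * ((v ⬝ᵥ (ω • a ω)) ^ 2 + (v ⬝ᵥ (ω • b ω)) ^ 2) -
        ϑ * ((ω • a ω) ⬝ᵥ (ω • a ω) + (ω • b ω) ⬝ᵥ (ω • b ω)) := by
    intro ω
    rw [mulVec_smul, show A *ᵥ b ω = ω • a ω from hA.mulVec_im_G B ω, f_eq_re_im]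
    simp only [smul_dotProduct, dotProduct_smul, smul_eq_mul, ha, hb]
    ring
  have hcontN : Continuous fun p : (Fin n → ℝ) × (Fin n → ℝ) => p.1 ⬝ᵥ p.1 + p.2 ⬝ᵥ p.2 := by
    fun_prop
  have hcontF : Continuous fun p : (Fin n → ℝ) × (Fin n → ℝ) =>
      2 * (v ⬝ᵥ (A *ᵥ p.2)) + κ * ((v ⬝ᵥ p.1) ^ 2 + (v ⬝ᵥ p.2) ^ 2) -
        ϑ * (p.1 ⬝ᵥ p.1 + p.2 ⬝ᵥ p.2) := by
    fun_prop
  have hpair := hlima.prodMk_nhds hlimb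
  have hN := (hcontN.tendsto _).comp hpair
  have hF := (hcontF.tendsto _).comp hpair
  have hpos : (0 : Fin n → ℝ) ⬝ᵥ 0 + (-B) ⬝ᵥ (-B) ≠ 0 := by
    simpa using hB
  refine ⟨_, ((hN.inv₀ hpos).mul hF).congr' ?_⟩
  filter_upwards [tendsto_norm_cocompact_atTop.eventually_gt_atTop (0 : ℝ)] with ω hω
  have hω0 : ω ^ 2 ≠ 0 := pow_ne_zero _ (norm_pos_iff.1 hω)
  simp only [Function.comp_apply]
  rw [← hnum, ← hnorm, mul_inv, mul_mul_mul_comm, inv_mul_cancel₀ hω0, one_mul]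

/-- Outside a compact set h exceeds L/2; on that set it attains a positive minimum. -/
theorem exists_pos_lower_bound {h : ℝ → ℝ} (hc : Continuous h) (hpos : ∀ ω, 0 < h ω) {L : ℝ}
    (hL : 0 < L) (hlim : Tendsto h (cocompact ℝ) (𝓝 L)) : ∃ ψ : ℝ, 0 < ψ ∧ ∀ ω, ψ ≤ h ω := by
  obtain ⟨t, ht, hsub⟩ := mem_cocompact.1 (hlim.eventually_const_lt (half_lt_self hL))
  rcases t.eq_empty_or_nonempty with rfl | hne
  · exact ⟨L / 2, half_pos hL, fun ω => (hsub (by simp : ω ∈ (∅ : Set ℝ)ᶜ)).le⟩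
  · obtain ⟨ω₀, -, hmin⟩ := ht.exists_isMinOn hne hc.continuousOn
    refine ⟨min (L / 2) (h ω₀), lt_min (half_pos hL) (hpos ω₀), fun ω => ?_⟩
    by_cases hω : ω ∈ t
    · exact (min_le_right _ _).trans (hmin hω)
    · exact (min_le_left _ _).trans (hsub hω).le

theorem IsHurwitz.continuous_ratio (hA : IsHurwitz A) {B : Fin n → ℝ} (hB : B ≠ 0)
    (κ ϑ : ℝ) (v : Fin n → ℝ) :
    Continuous fun ω : ℝ => (euclNorm (G A B (Complex.I * ω)) ^ 2)⁻¹ * f A B ω κ ϑ v := by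
  have hG := hA.continuous_G B
  have hN : Continuous fun ω : ℝ => euclNorm (G A B (Complex.I * ω)) ^ 2 := by
    simp_rw [euclNorm_sq]
    fun_prop
  refine (hN.inv₀ fun ω => (euclNorm_sq_pos (hA.G_ne_zero hB (by simp))).ne').mul ?_
  unfold f
  have hd : Continuous fun ω : ℝ => (fun i => (v i : ℂ)) ⬝ᵥ G A B (Complex.I * ω) :=
    continuous_const.dotProduct hG
  exact ((continuous_const.mul (Complex.continuous_re.comp hd)).add
    (continuous_const.mul (hd.norm.pow 2))).sub (continuous_const.mul hN)

end HighFrequency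

/-! ### The minimal eigenvalue as a lower bound of the quadratic form -/

section MinimalEigenvalue

variable {n : ℕ}

theorem lambdaMin_mul_le (hn : 0 < n) {M : Matrix (Fin n) (Fin n) ℝ} (hM : M.IsSymm)
    (x : Fin n → ℝ) : lambdaMin M * (x ⬝ᵥ x) ≤ x ⬝ᵥ (M *ᵥ x) := by
  have hs : (M - lambdaMin M • (1 : Matrix (Fin n) (Fin n) ℝ)).IsSymm :=
    hM.sub (isSymm_one.smul _)
  have hH : (M - lambdaMin M • (1 : Matrix (Fin n) (Fin n) ℝ)).IsHermitian := by
    rwa [IsHermitian, conjTranspose_eq_transpose_of_trivial]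
  have hpsd : (M - lambdaMin M • (1 : Matrix (Fin n) (Fin n) ℝ)).PosSemidef := by
    rw [hH.posSemidef_iff_eigenvalues_nonneg]
    intro i
    have h1 := hH.eigenvalues_mem_spectrum_real i
    generalize hH.eigenvalues i = e at h1 ⊢
    rw [← Algebra.algebraMap_eq_smul_one, ← spectrum.sub_singleton_eq] at h1
    obtain ⟨μ, hμ, ν, hν, h2⟩ := Set.mem_sub.1 h1
    rw [Set.mem_singleton_iff.1 hν] at h2
    have h3 := (lambdaMin_isLeast hn hM).2 hμ
    change 0 ≤ _
    linarith
  have h := (posSemidef_iff_real.1 hpsd).2 x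
  rw [sub_mulVec, smul_mulVec, one_mulVec, dotProduct_sub, dotProduct_smul, smul_eq_mul] at h
  linarith

theorem exists_lambdaMin_eigenvector (hn : 0 < n) {M : Matrix (Fin n) (Fin n) ℝ}
    (hM : M.IsSymm) : ∃ x : Fin n → ℝ, x ≠ 0 ∧ M *ᵥ x = lambdaMin M • x := by
  have h := (lambdaMin_isLeast hn hM).1
  rw [← spectrum_toLin', ← Module.End.hasEigenvalue_iff_mem_spectrum] at h
  obtain ⟨x, hx⟩ := h.exists_hasEigenvector
  exact ⟨x, hx.2, by simpa using hx.apply_eq_smul⟩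

end MinimalEigenvalue

/-! ### Solutions of the matrix inequality and the three assertions -/

section LinearMatrixInequality

variable {n : ℕ} {A P : Matrix (Fin n) (Fin n) ℝ} {B v : Fin n → ℝ} {κ ψ : ℝ}

theorem SolvesLMI.quadratic (h : SolvesLMI A B v κ ψ P) (x : Fin n → ℝ) :
    x ⬝ᵥ ((Aᵀ * P + P * A) *ᵥ x) + (ψ + κ * euclNorm v ^ 2) * (x ⬝ᵥ x) -
      κ * (v ⬝ᵥ x) ^ 2 ≤ 0 := by
  have h1 := (posSemidef_iff_real.1 h.2.1).2 x
  rw [neg_mulVec, dotProduct_neg, sub_mulVec, add_mulVec _ (_ • 1), smul_mulVec, smul_mulVec,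
    one_mulVec, vecMulVec_mulVec, dotProduct_sub, dotProduct_add, dotProduct_smul,
    dotProduct_smul] at h1
  simp [dotProduct_comm x v] at h1
  nlinarith

/-- By Cauchy–Schwarz, κ‖v‖² I - κ vvᵀ ≥ 0, so this part can be dropped. -/
theorem SolvesLMI.lyapunov (hκ : 0 ≤ κ) (h : SolvesLMI A B v κ ψ P) (x : Fin n → ℝ) :
    x ⬝ᵥ ((Aᵀ * P + P * A) *ᵥ x) ≤ -(ψ * (x ⬝ᵥ x)) := by
  have h1 := h.quadratic x
  have hcs : (v ⬝ᵥ x) ^ 2 ≤ euclNorm v ^ 2 * (x ⬝ᵥ x) := by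
    rw [euclNorm_sq_real]
    simpa [dotProduct, sq] using Finset.sum_mul_sq_le_sq_mul_sq Finset.univ v x
  nlinarith [mul_le_mul_of_nonneg_left hcs hκ]

theorem dotProduct_self_pos {x : Fin n → ℝ} (hx : x ≠ 0) : 0 < x ⬝ᵥ x :=
  euclNorm_sq_real x ▸ euclNorm_sq_pos hx

theorem SolvesLMI.isSymm_lyapunovQ (h : SolvesLMI A B v κ ψ P) : (lyapunovQ A P).IsSymm := by
  rw [lyapunovQ, IsSymm, transpose_neg, transpose_add, transpose_mul, transpose_mul,
    transpose_transpose, h.1.eq, add_comm]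

theorem SolvesLMI.posDef_lyapunovQ (hκ : 0 ≤ κ) (hψ : 0 < ψ) (h : SolvesLMI A B v κ ψ P) :
    (lyapunovQ A P).PosDef := by
  rw [posDef_iff_real]
  refine ⟨h.isSymm_lyapunovQ, fun x hx => ?_⟩
  have h1 := h.lyapunov hκ x
  have h2 := mul_pos hψ (dotProduct_self_pos hx)
  rw [lyapunovQ, neg_mulVec, dotProduct_neg]
  linarith

theorem SolvesLMI.posDef (hA : IsHurwitz A) (hκ : 0 ≤ κ) (hψ : 0 < ψ)
    (h : SolvesLMI A B v κ ψ P) : P.PosDef := by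
  have hself : ∀ x : Fin n → ℝ, 0 ≤ x ⬝ᵥ x := fun x => by
    rw [← euclNorm_sq_real]
    positivity
  have hpsd : P.PosSemidef := hA.posSemidef_of_lyapunov h.1 fun x =>
    (h.lyapunov hκ x).trans (neg_nonpos.2 (mul_nonneg hψ.le (hself x)))
  rw [posDef_iff_real]
  refine ⟨h.1, fun x hx => lt_of_le_of_ne ((posSemidef_iff_real.1 hpsd).2 x) fun h0 => ?_⟩
  have hPx := mulVec_eq_zero_of_quadratic_eq_zero hpsd h0.symm
  have h1 := h.lyapunov hκ x
  rw [quadratic_lyapunov h.1, dotProduct_mulVec_symm h.1, hPx, dotProduct_zero] at h1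
  have h2 := mul_pos hψ (dotProduct_self_pos hx)
  linarith

theorem SolvesLMI.lambdaMin_lt (hn : 0 < n) (hA : IsHurwitz A) (h : SolvesLMI A B v κ ψ P)
    (hω : ∃ ω : ℝ, f A B ω 0 (ψ + κ * euclNorm v ^ 2) v < 0) :
    lambdaMin (lyapunovQ A P) < g 1 (lyapunovQ A P) (P *ᵥ B) := by
  obtain ⟨ω, hω⟩ := hω
  by_contra! hle
  rw [h.2.2, g, one_smul] at hle
  set Q := lyapunovQ A P with hQ
  have hQs : Q.IsSymm := h.isSymm_lyapunovQ
  have hQq : ∀ x, x ⬝ᵥ (Q *ᵥ x) = -(x ⬝ᵥ ((Aᵀ * P + P * A) *ᵥ x)) := by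
    intro x
    rw [hQ, lyapunovQ, neg_mulVec, dotProduct_neg]
  have hMs : (Q + vecMulVec v v).IsSymm := by
    rw [IsSymm, transpose_add, hQs.eq, transpose_vecMulVec]
  obtain ⟨x, hx, hxe⟩ := exists_lambdaMin_eigenvector hn hMs
  have hxx := dotProduct_self_pos hx
  have h1 : x ⬝ᵥ (Q *ᵥ x) + (v ⬝ᵥ x) ^ 2 = lambdaMin (Q + vecMulVec v v) * (x ⬝ᵥ x) := by
    have := congrArg (x ⬝ᵥ ·) hxe
    simp only [add_mulVec, vecMulVec_mulVec, dotProduct_add, dotProduct_smul, smul_eq_mul] at this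
    rw [← this]
    simp [dotProduct_comm x v, sq]
  have h2 := lambdaMin_mul_le hn hQs x
  have h3 := mul_le_mul_of_nonneg_right hle hxx.le
  -- xᵀQx + (vᵀx)² ≤ λ_min(Q) xᵀx ≤ xᵀQx.
  have hvx : (v ⬝ᵥ x) ^ 2 = 0 := le_antisymm (by linarith) (sq_nonneg _)
  have hθ : ψ + κ * euclNorm v ^ 2 ≤ lambdaMin Q := by
    have h4 := h.quadratic x
    rw [hvx, mul_zero, sub_zero] at h4
    have h5 := hQq x
    exact le_of_mul_le_mul_right (by linarith) hxx
  -- The bound Q ≥ (ψ + κ‖v‖²)I is the matrix inequality with κ = 0.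
  refine absurd (hA.f_nonneg_of_lmi (κ := 0) h.1 h.2.2 (fun y => ?_) ω) (not_le.2 hω)
  have h6 := lambdaMin_mul_le hn hQs y
  have h7 : 0 ≤ y ⬝ᵥ y := by
    rw [← euclNorm_sq_real]
    positivity
  have h8 := mul_le_mul_of_nonneg_right hθ h7
  rw [hQq] at h6
  linarith

theorem psi_nonempty_iff (hn : 0 < n) (hA : IsHurwitz A) (hAB : IsControllable A B) :
    (Psi A B v κ).Nonempty ↔
      (∀ ω : ℝ, 0 < f A B ω κ (κ * euclNorm v ^ 2) v) ∧
      ∃ L : ℝ, 0 < L ∧ Tendsto (fun ω : ℝ => (euclNorm (G A B (Complex.I * ω)) ^ 2)⁻¹ *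
        f A B ω κ (κ * euclNorm v ^ 2) v) atTop (𝓝 L) := by
  have hB : B ≠ 0 := hAB.ne_zero hn
  have hGpos : ∀ ω : ℝ, 0 < euclNorm (G A B (Complex.I * ω)) ^ 2 := fun ω =>
    euclNorm_sq_pos (hA.G_ne_zero hB (by simp))
  have hshift : ∀ ω ψ : ℝ, f A B ω κ (ψ + κ * euclNorm v ^ 2) v =
      f A B ω κ (κ * euclNorm v ^ 2) v - ψ * euclNorm (G A B (Complex.I * ω)) ^ 2 := by
    intro ω ψ
    rw [f, f]
    ring
  obtain ⟨L, hL⟩ := hA.exists_tendsto_ratio hB κ (κ * euclNorm v ^ 2) v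
  constructor
  · rintro ⟨ψ, hψ, P, hP⟩
    have hf : ∀ ω : ℝ, ψ * euclNorm (G A B (Complex.I * ω)) ^ 2 ≤
        f A B ω κ (κ * euclNorm v ^ 2) v := by
      intro ω
      have := hA.f_nonneg_of_lmi hP.1 hP.2.2 hP.quadratic ω
      rw [hshift] at this
      linarith
    refine ⟨fun ω => (mul_pos hψ (hGpos ω)).trans_le (hf ω), L, ?_, hL.mono_left atTop_le_cocompact⟩
    refine hψ.trans_le (ge_of_tendsto' hL fun ω => ?_)
    rw [← div_eq_inv_mul, le_div_iff₀ (hGpos ω)]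
    exact hf ω
  · rintro ⟨hpos, L', hL', hlim⟩
    -- The hypothesis concerns ω → +∞ only; the existing two-sided limit must agree with it, which
    -- also controls ω → -∞.
    have hLL : L = L' := tendsto_nhds_unique (hL.mono_left atTop_le_cocompact) hlim
    obtain ⟨ψ, hψ, hbound⟩ := exists_pos_lower_bound (hA.continuous_ratio hB _ _ v)
      (fun ω => mul_pos (inv_pos.2 (hGpos ω)) (hpos ω)) (hLL ▸ hL') hL
    obtain ⟨P, hP, hPB, hlmi⟩ := hA.exists_lmi_solution (v := v) (κ := κ)
      (ϑ := ψ + κ * euclNorm v ^ 2) hAB fun ω => by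
        have := hbound ω
        rw [← div_eq_inv_mul, le_div_iff₀ (hGpos ω)] at this
        rw [hshift]
        linarith
    exact ⟨ψ, hψ, P, hP, hlmi, hPB⟩

end LinearMatrixInequality

end StaticAdaptation

theorem theorem3 {n : ℕ} (hn : 0 < n)
    (A : Matrix (Fin n) (Fin n) ℝ) (B v : Fin n → ℝ) (κ : ℝ)
    (hA : StaticAdaptation.IsHurwitz A) (hAB : StaticAdaptation.IsControllable A B)
    (hκ : 0 < κ) :
    ((StaticAdaptation.Psi A B v κ).Nonempty ↔
      (∀ ω : ℝ, 0 < StaticAdaptation.f A B ω κ (κ * StaticAdaptation.euclNorm v ^ 2) v) ∧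
      ∃ L : ℝ, 0 < L ∧
        Filter.Tendsto
          (fun ω : ℝ =>
            (StaticAdaptation.euclNorm (StaticAdaptation.G A B (Complex.I * ω)) ^ 2)⁻¹ *
              StaticAdaptation.f A B ω κ (κ * StaticAdaptation.euclNorm v ^ 2) v)
          Filter.atTop (nhds L)) ∧
    (∀ ψ ∈ StaticAdaptation.Psi A B v κ, ∀ P : Matrix (Fin n) (Fin n) ℝ,
      StaticAdaptation.SolvesLMI A B v κ ψ P →
        P.PosDef ∧ (StaticAdaptation.lyapunovQ A P).PosDef ∧
        ((∃ ω : ℝ,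
            StaticAdaptation.f A B ω 0 (ψ + κ * StaticAdaptation.euclNorm v ^ 2) v < 0) →
          StaticAdaptation.lambdaMin (StaticAdaptation.lyapunovQ A P) <
            StaticAdaptation.g 1 (StaticAdaptation.lyapunovQ A P) (Matrix.mulVec P B))) :=
  ⟨StaticAdaptation.psi_nonempty_iff hn hA hAB, fun _ hψ _ hP =>
    ⟨hP.posDef hA hκ.le hψ.1, hP.posDef_lyapunovQ hκ.le hψ.1, hP.lambdaMin_lt hn hA⟩⟩
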